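/- Let $a>0$. Let $C=D_2\times S^1=\{(x,y,\varphi)\,:\,x^2+y^2<1,\ \varphi\in\mathbb R/2\pi\mathbb Z\}$. Then there is a (unique) metric $d$ on the set $C$ such that, for all points $(x,y,\varphi)$, $(x',y',\varphi')$ of $C$, \[ \cosh d\big((x,y,\varphi),(x',y',\varphi')\big)=\frac{\cosh\!\big(a(\varphi-\varphi'+2n\pi)\big)-xx'-yy'}{\sqrt{1-x^2-y^2}\,\sqrt{1-x'^2-y'^2}}, \] where the integer $n$ is chosen such that $\varphi-\varphi'+2n\pi\in(-\pi,\pi]$. The metric space $(C,d)$ is isometric to the nonrotating Euclidean BTZ space with parameter $a$, equipped with its Riemannian distance (the infimum of the lengths of the $C^1$ paths between two points). Here the nonrotating Euclidean BTZ space with parameter $a$ is the Riemannian manifold with metric \[ ds^2=(\rho^2-a^2)\,d\tau^2+\frac{d\rho^2}{\rho^2-a^2}+\rho^2\,d\varphi^2,\qquad a\le\rho<\infty,\quad \varphi\sim\varphi+2\pi,\quad \tau\sim\tau+\tfrac{2\pi}{a}, \] the points with $\rho=a$ and the same $\varphi$ being identified. Precisely, it is the smooth manifold $\mathbb R^2\times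 S^1$, where $(\rho,\tau)$ are polar coordinates on $\mathbb R^2=\mathbb C$ through $Z=\tfrac{\sqrt{\rho^2-a^2}}{a}\,e^{ia\tau}$ and $\varphi$ is the angle on $S^1$, with the smooth extension of $ds^2$ across $\rho=a$, namely $ds^2=|dZ|^2-\frac{(Z\cdot dZ)^2}{1+|Z|^2}+a^2(1+|Z|^2)\,d\varphi^2$. -/

import Mathlib

open scoped Manifold ContDiff InnerProductSpace

noncomputable section

attribute [local instance] finrank_real_complex_fact'

/-- The manifold underlying the nonrotating Euclidean BTZ space: the range `a ≤ ρ < ∞`,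
`φ ∼ φ + 2π`, `τ ∼ τ + 2π / a` of the coordinates `(ρ, τ, φ)`, with all the values of `τ`
identified at `ρ = a`. It is the smooth manifold `ℝ² × S¹`, where `(ρ, τ)` are polar coordinates
on `ℝ² = ℂ` through `Z = (√(ρ² - a²) / a) e^{i a τ}` and `φ` is the angle on `S¹`; see
`EuclideanBTZ.polar` below. (The parameter `a` matters for the metric only.) -/
def EuclideanBTZ (_a : ℝ) : Type := ℂ × Circle

namespace EuclideanBTZ

/-- The smooth manifold `ℂ × S¹` is modelled on `ℂ × ℝ¹`, over the reals. -/
abbrev model : ModelWithCorners ℝ (ℂ × EuclideanSpace ℝ (Fin 1))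
    (ModelProd ℂ (EuclideanSpace ℝ (Fin 1))) :=
  𝓘(ℝ, ℂ).prod (𝓡 1)

instance (a : ℝ) : TopologicalSpace (EuclideanBTZ a) :=
  inferInstanceAs (TopologicalSpace (ℂ × Circle))

instance (a : ℝ) : T3Space (EuclideanBTZ a) :=
  inferInstanceAs (T3Space (ℂ × Circle))

instance (a : ℝ) : ChartedSpace (ModelProd ℂ (EuclideanSpace ℝ (Fin 1))) (EuclideanBTZ a) :=
  inferInstanceAs (ChartedSpace _ (ℂ × Circle))

instance (a : ℝ) : IsManifold model ω (EuclideanBTZ a) :=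
  inferInstanceAs (IsManifold (𝓘(ℝ, ℂ).prod (𝓡 1)) ω (ℂ × Circle))

instance (a : ℝ) : IsManifold model ∞ (EuclideanBTZ a) := .of_le (n := ω) le_top

/-- The smooth embedding `(Z, e^{iφ})` of `ℂ × S¹` in `ℂ × ℂ`. -/
def coords {a : ℝ} (p : EuclideanBTZ a) : ℂ × ℂ := (p.1, (p.2 : ℂ))

lemma contMDiff_coords (a : ℝ) :
    ContMDiff model 𝓘(ℝ, ℂ × ℂ) ∞ (coords : EuclideanBTZ a → ℂ × ℂ) := by
  have h1 : ContMDiff (𝓘(ℝ, ℂ).prod (𝓡 1)) 𝓘(ℝ, ℂ) ∞ (fun p : ℂ × Circle ↦ p.1) :=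
    contMDiff_fst
  have h2 : ContMDiff (𝓘(ℝ, ℂ).prod (𝓡 1)) 𝓘(ℝ, ℂ) ∞ (fun p : ℂ × Circle ↦ (p.2 : ℂ)) :=
    (contMDiff_coe_sphere (E := ℂ) (n := 1)).comp contMDiff_snd
  exact h1.prodMk_space h2

/-- The real inner product of `ℂ = ℝ²` as a continuous bilinear form. -/
def dotForm : ℂ →L[ℝ] ℂ →L[ℝ] ℝ := innerSL ℝ

lemma dotForm_apply (v w : ℂ) : dotForm v w = ⟪v, w⟫_ℝ := rfl

/-- The bilinear form `V₁ · W₁ - (Z · V₁) (Z · W₁) / (1 + |Z|²) + a² (1 + |Z|²) V₂ · W₂`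
on `ℂ × ℂ`; see `ambientForm_apply`. -/
def ambientForm (a : ℝ) (z : ℂ) : (ℂ × ℂ) →L[ℝ] (ℂ × ℂ) →L[ℝ] ℝ :=
  dotForm.bilinearComp (.fst ℝ ℂ ℂ) (.fst ℝ ℂ ℂ)
    - (1 + ‖z‖ ^ 2)⁻¹ •
      (dotForm z ∘L .fst ℝ ℂ ℂ).smulRight (dotForm z ∘L .fst ℝ ℂ ℂ)
    + (a ^ 2 * (1 + ‖z‖ ^ 2)) • dotForm.bilinearComp (.snd ℝ ℂ ℂ) (.snd ℝ ℂ ℂ)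

lemma ambientForm_apply (a : ℝ) (z : ℂ) (V W : ℂ × ℂ) :
    ambientForm a z V W = ⟪V.1, W.1⟫_ℝ - ⟪z, V.1⟫_ℝ * ⟪z, W.1⟫_ℝ / (1 + ‖z‖ ^ 2)
      + a ^ 2 * (1 + ‖z‖ ^ 2) * ⟪V.2, W.2⟫_ℝ := by
  simp [-Complex.inner, ambientForm, div_eq_inv_mul, dotForm_apply]

lemma contDiff_ambientForm (a : ℝ) : ContDiff ℝ ∞ (ambientForm a) := by
  have h : ∀ z : ℂ, 1 + ‖z‖ ^ 2 ≠ 0 := fun z ↦ by positivity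
  have h' : ContDiff ℝ ∞ fun z : ℂ ↦ 1 + ‖z‖ ^ 2 := contDiff_const.add (contDiff_norm_sq ℝ)
  refine contDiff_clm_apply_iff.2 fun V ↦ contDiff_clm_apply_iff.2 fun W ↦ ?_
  simp only [ambientForm_apply]
  exact (contDiff_const.sub (((contDiff_id.inner ℝ contDiff_const).mul
    (contDiff_id.inner ℝ contDiff_const)).div h' h)).add
    ((contDiff_const.mul h').mul contDiff_const)

lemma ambientForm_ge (a : ℝ) (z : ℂ) (V : ℂ × ℂ) :
    (1 + ‖z‖ ^ 2)⁻¹ * ‖V.1‖ ^ 2 + a ^ 2 * (1 + ‖z‖ ^ 2) * ‖V.2‖ ^ 2 ≤ ambientForm a z V V := by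
  rw [ambientForm_apply, real_inner_self_eq_norm_sq, real_inner_self_eq_norm_sq]
  have h : ⟪z, V.1⟫_ℝ * ⟪z, V.1⟫_ℝ ≤ ‖z‖ ^ 2 * ‖V.1‖ ^ 2 := by
    nlinarith [real_inner_mul_inner_self_le z V.1, real_inner_self_eq_norm_sq z,
      real_inner_self_eq_norm_sq V.1]
  have hz : 0 < 1 + ‖z‖ ^ 2 := by positivity
  have : (1 + ‖z‖ ^ 2)⁻¹ * ‖V.1‖ ^ 2 ≤ ‖V.1‖ ^ 2 - ⟪z, V.1⟫_ℝ * ⟪z, V.1⟫_ℝ / (1 + ‖z‖ ^ 2) := by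
    rw [inv_mul_eq_div, le_sub_iff_add_le, ← add_div, div_le_iff₀ hz]
    nlinarith
  linarith

lemma ambientForm_pos {a : ℝ} (ha : 0 < a) (z : ℂ) {V : ℂ × ℂ} (hV : V ≠ 0) :
    0 < ambientForm a z V V := by
  refine lt_of_lt_of_le ?_ (ambientForm_ge a z V)
  have hz : 0 < 1 + ‖z‖ ^ 2 := by positivity
  by_cases h1 : V.1 = 0
  · have h2 : V.2 ≠ 0 := fun h2 ↦ hV (Prod.ext h1 h2)
    have := norm_pos_iff.2 h2
    positivity
  · have := norm_pos_iff.2 h1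
    positivity

/-- The differential of `(Z, e^{iφ})`, that is `v ↦ (dZ v, d(e^{iφ}) v)`; note that
`|d(e^{iφ}) v|² = dφ(v)²`. -/
def frame {a : ℝ} (p : EuclideanBTZ a) : (ℂ × EuclideanSpace ℝ (Fin 1)) →L[ℝ] ℂ × ℂ :=
  mvfderiv model coords p

lemma frame_apply {a : ℝ} (p : EuclideanBTZ a) (v : ℂ × EuclideanSpace ℝ (Fin 1)) :
    frame p v = (v.1, mvfderiv (𝓡 1) (fun u : Circle ↦ (u : ℂ)) p.2 v.2) := by
  have h1 : HasMFDerivAt (𝓘(ℝ, ℂ).prod (𝓡 1)) 𝓘(ℝ, ℂ) (Prod.fst : ℂ × Circle → ℂ) p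
      (ContinuousLinearMap.fst ℝ ℂ (EuclideanSpace ℝ (Fin 1))) := hasMFDerivAt_fst p
  have h2 : HasMFDerivAt (𝓘(ℝ, ℂ).prod (𝓡 1)) (𝓡 1) (Prod.snd : ℂ × Circle → Circle) p
      (ContinuousLinearMap.snd ℝ ℂ (EuclideanSpace ℝ (Fin 1))) := hasMFDerivAt_snd p
  have h3 : HasMFDerivAt (𝓡 1) 𝓘(ℝ, ℂ) (fun u : Circle ↦ (u : ℂ)) p.2
      (mfderiv (𝓡 1) 𝓘(ℝ, ℂ) (fun u : Circle ↦ (u : ℂ)) p.2) :=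
    ((contMDiff_coe_sphere (E := ℂ) (n := 1) (m := 1) p.2).mdifferentiableAt
      one_ne_zero).hasMFDerivAt
  have h4 := HasMFDerivAt.comp p h3 h2
  have h5 : HasMFDerivAt model 𝓘(ℝ, ℂ × ℂ) (coords : EuclideanBTZ a → ℂ × ℂ) p
      (mfderiv model 𝓘(ℝ, ℂ × ℂ) coords p) :=
    (contMDiff_coords a p).mdifferentiableAt (by simp) |>.hasMFDerivAt
  have h6 := (ContinuousLinearMap.fst ℝ ℂ ℂ).hasMFDerivAt.comp p h5
  have h7 := (ContinuousLinearMap.snd ℝ ℂ ℂ).hasMFDerivAt.comp p h5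
  refine Prod.ext ?_ ?_
  · exact congrArg (fun f ↦ f v) (hasMFDerivAt_unique h6 h1)
  · exact congrArg (fun f ↦ f v) (hasMFDerivAt_unique h7 h4)

lemma frame_injective {a : ℝ} (p : EuclideanBTZ a) : Function.Injective (frame p) := by
  intro v w h
  rw [frame_apply, frame_apply, Prod.mk.injEq] at h
  exact Prod.ext h.1 (injective_mvfderiv_subtypeVal_sphere (E := ℂ) (n := 1) p.2 h.2)

/-- The metric `ds² = |dZ|² - (Z · dZ)² / (1 + |Z|²) + a² (1 + |Z|²) dφ²` on `ℂ × S¹`. In the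
coordinates `(ρ, τ, φ)` this is `(ρ² - a²) dτ² + dρ² / (ρ² - a²) + ρ² dφ²`, as is proved in
`metricForm_polar` below; it is the smooth extension of that metric across `ρ = a`. -/
def metricForm {a : ℝ} (p : EuclideanBTZ a) : (ℂ × EuclideanSpace ℝ (Fin 1)) →L[ℝ]
    (ℂ × EuclideanSpace ℝ (Fin 1)) →L[ℝ] ℝ :=
  (ambientForm a p.1).bilinearComp (frame p) (frame p)

lemma metricForm_pos {a : ℝ} (ha : 0 < a) (p : EuclideanBTZ a)
    {v : ℂ × EuclideanSpace ℝ (Fin 1)} (hv : v ≠ 0) : 0 < metricForm p v v :=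
  ambientForm_pos ha p.1 fun h ↦ hv (frame_injective p (h.trans (map_zero _).symm))

lemma metricForm_symm {a : ℝ} (p : EuclideanBTZ a)
    (v w : ℂ × EuclideanSpace ℝ (Fin 1)) : metricForm p v w = metricForm p w v := by
  simp only [metricForm, ContinuousLinearMap.bilinearComp_apply]
  rw [ambientForm_apply, ambientForm_apply, real_inner_comm (frame p w).1,
    real_inner_comm (frame p w).2, mul_comm ⟪p.1, (frame p v).1⟫_ℝ]

lemma metricForm_bounded {a : ℝ} (ha : 0 < a) (p : EuclideanBTZ a) :
    Bornology.IsVonNBounded ℝ {v | metricForm p v v < 1} := by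
  obtain ⟨K, hK, hanti⟩ := (frame p).toLinearMap.injective_iff_antilipschitz.1 (frame_injective p)
  have hz : 0 < 1 + ‖p.1‖ ^ 2 := by positivity
  have hb : Bornology.IsBounded {V : ℂ × ℂ | ambientForm a p.1 V V < 1} := by
    refine (Metric.isBounded_closedBall (x := (0 : ℂ × ℂ))
      (r := 1 + ‖p.1‖ ^ 2 + a⁻¹)).subset fun V hV ↦ ?_
    have hV : ambientForm a p.1 V V < 1 := hV
    have h := (ambientForm_ge a p.1 V).trans_lt hV
    have h1 : (1 + ‖p.1‖ ^ 2)⁻¹ * ‖V.1‖ ^ 2 < 1 :=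
      lt_of_le_of_lt (le_add_of_nonneg_right (by positivity)) h
    have h2 : a ^ 2 * (1 + ‖p.1‖ ^ 2) * ‖V.2‖ ^ 2 < 1 :=
      lt_of_le_of_lt (le_add_of_nonneg_left (by positivity)) h
    rw [inv_mul_lt_iff₀ hz, mul_one] at h1
    have h3 : (a * ‖V.2‖) ^ 2 ≤ 1 := by
      nlinarith [mul_nonneg (sq_nonneg (a * ‖V.2‖)) (sq_nonneg ‖p.1‖)]
    have h4 : a * ‖V.2‖ ≤ 1 := by
      rw [sq_le_one_iff₀ (by positivity)] at h3; exact h3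
    have h5 : ‖V.2‖ ≤ a⁻¹ := by
      rw [← one_div, le_div_iff₀ ha, mul_comm]
      exact h4
    have h6 : ‖V.1‖ ≤ 1 + ‖p.1‖ ^ 2 := by nlinarith [sq_nonneg ‖p.1‖]
    rw [mem_closedBall_zero_iff, Prod.norm_def]
    have := inv_pos.2 ha
    exact max_le (by linarith) (by linarith)
  rw [NormedSpace.isVonNBounded_iff]
  exact hanti.isBounded_preimage hb

/-- The map `frame q` read in the chart at `p`. -/
def frameIn {a : ℝ} (p q : EuclideanBTZ a) :
    (ℂ × EuclideanSpace ℝ (Fin 1)) →L[ℝ] ℂ × ℂ :=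
  inTangentCoordinates model 𝓘(ℝ, ℂ × ℂ) id coords (fun q : EuclideanBTZ a ↦ frame q) p q

lemma contMDiffAt_frameIn {a : ℝ} (p : EuclideanBTZ a) :
    ContMDiffAt model 𝓘(ℝ, (ℂ × EuclideanSpace ℝ (Fin 1)) →L[ℝ] ℂ × ℂ) ∞ (frameIn p) p :=
  ContMDiffAt.mfderiv_const (n := ∞) ((contMDiff_coords a) p) (by simp)

lemma frameIn_apply {a : ℝ} (p q : EuclideanBTZ a)
    (hq : q ∈ (trivializationAt (ℂ × EuclideanSpace ℝ (Fin 1))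
      (TangentSpace model : EuclideanBTZ a → Type) p).baseSet)
    (v : ℂ × EuclideanSpace ℝ (Fin 1)) :
    frameIn p q v = frame q ((trivializationAt (ℂ × EuclideanSpace ℝ (Fin 1))
        (TangentSpace model : EuclideanBTZ a → Type) p).symm q v) := by
  have h : frameIn p q v = frame q (Bundle.Trivialization.symmL ℝ
      (trivializationAt (ℂ × EuclideanSpace ℝ (Fin 1))
        (TangentSpace model : EuclideanBTZ a → Type) p) q v) := by
    simp [frameIn, inTangentCoordinates, ContinuousLinearMap.inCoordinates]
    rfl
  exact h.trans (congrArg (frame q) (Bundle.Trivialization.symmL_apply _ hq v))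

/-- The pullback of a bilinear form by a linear map. -/
def pullForm {E F : Type*} [NormedAddCommGroup E] [NormedSpace ℝ E] [NormedAddCommGroup F]
    [NormedSpace ℝ F] (A : F →L[ℝ] F →L[ℝ] ℝ) (L : E →L[ℝ] F) : E →L[ℝ] E →L[ℝ] ℝ :=
  (L.precomp ℝ) ∘L (A ∘L L)

lemma contDiff_pullForm {E F : Type*} [NormedAddCommGroup E] [NormedSpace ℝ E]
    [NormedAddCommGroup F] [NormedSpace ℝ F] [FiniteDimensional ℝ E] :
    ContDiff ℝ ∞ fun x : (F →L[ℝ] F →L[ℝ] ℝ) × (E →L[ℝ] F) ↦ pullForm x.1 x.2 := by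
  refine contDiff_clm_apply_iff.2 fun v ↦ contDiff_clm_apply_iff.2 fun w ↦ ?_
  change ContDiff ℝ ∞ fun x : (F →L[ℝ] F →L[ℝ] ℝ) × (E →L[ℝ] F) ↦ x.1 (x.2 v) (x.2 w)
  exact (contDiff_fst.clm_apply (contDiff_snd.clm_apply contDiff_const)).clm_apply
    (contDiff_snd.clm_apply contDiff_const)

lemma contMDiffAt_pullForm {E F : Type*} [NormedAddCommGroup E] [NormedSpace ℝ E]
    [NormedAddCommGroup F] [NormedSpace ℝ F] [FiniteDimensional ℝ E] {E' H M : Type*} [NormedAddCommGroup E']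
    [NormedSpace ℝ E'] [TopologicalSpace H] {I : ModelWithCorners ℝ E' H} [TopologicalSpace M]
    [ChartedSpace H M] {A : M → F →L[ℝ] F →L[ℝ] ℝ} {L : M → E →L[ℝ] F} {p : M}
    (hA : ContMDiffAt I 𝓘(ℝ, F →L[ℝ] F →L[ℝ] ℝ) ∞ A p)
    (hL : ContMDiffAt I 𝓘(ℝ, E →L[ℝ] F) ∞ L p) :
    ContMDiffAt I 𝓘(ℝ, E →L[ℝ] E →L[ℝ] ℝ) ∞ (fun q ↦ pullForm (A q) (L q)) p :=
  ContDiffAt.comp_contMDiffAt (g := fun x : (F →L[ℝ] F →L[ℝ] ℝ) × (E →L[ℝ] F) ↦ pullForm x.1 x.2)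
    (f := fun q ↦ (A q, L q)) contDiff_pullForm.contDiffAt (hA.prodMk_space hL)

/-- The form `metricForm q` read in the chart at `p`. -/
def metricIn {a : ℝ} (p q : EuclideanBTZ a) : (ℂ × EuclideanSpace ℝ (Fin 1)) →L[ℝ]
      (ℂ × EuclideanSpace ℝ (Fin 1)) →L[ℝ] ℝ :=
  pullForm (ambientForm a q.1) (frameIn p q)

lemma contMDiffAt_ambientForm {a : ℝ} (p : EuclideanBTZ a) :
    ContMDiffAt model 𝓘(ℝ, (ℂ × ℂ) →L[ℝ] (ℂ × ℂ) →L[ℝ] ℝ) ∞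
      (fun q : EuclideanBTZ a ↦ ambientForm a q.1) p := by
  have h : ContMDiffAt model 𝓘(ℝ, ℂ) ∞ (fun q : EuclideanBTZ a ↦ q.1) p :=
    (contDiff_fst.contMDiff.comp (contMDiff_coords a)) p
  exact (contDiff_ambientForm a).contDiffAt.comp_contMDiffAt h

lemma contMDiffAt_metricIn {a : ℝ} (p : EuclideanBTZ a) :
    ContMDiffAt model 𝓘(ℝ, (ℂ × EuclideanSpace ℝ (Fin 1)) →L[ℝ]
      (ℂ × EuclideanSpace ℝ (Fin 1)) →L[ℝ] ℝ) ∞ (metricIn p) p :=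
  contMDiffAt_pullForm (contMDiffAt_ambientForm p) (contMDiffAt_frameIn p)

lemma metricIn_eq {a : ℝ} (p q : EuclideanBTZ a)
    (hq : q ∈ (trivializationAt (ℂ × EuclideanSpace ℝ (Fin 1))
      (TangentSpace model : EuclideanBTZ a → Type) p).baseSet) :
    ContinuousLinearMap.inCoordinates (ℂ × EuclideanSpace ℝ (Fin 1))
      (TangentSpace model : EuclideanBTZ a → Type) ((ℂ × EuclideanSpace ℝ (Fin 1)) →L[ℝ] ℝ)
      (fun p : EuclideanBTZ a ↦ TangentSpace model p →L[ℝ] ℝ) p q p q (metricForm q)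
      = metricIn p q := by
  refine ContinuousLinearMap.ext fun v ↦ ContinuousLinearMap.ext fun w ↦ ?_
  refine (inCoordinates_apply_eq₂ (E₃ := Bundle.Trivial (EuclideanBTZ a) ℝ) hq hq
    (Set.mem_univ _)).trans ?_
  have h : ∀ r : ℝ, Bundle.Trivialization.linearMapAt ℝ
      (trivializationAt ℝ (Bundle.Trivial (EuclideanBTZ a) ℝ) p) q r = r := by
    intro r; simp
  refine (h _).trans ?_
  change metricForm q _ _ = ambientForm a q.1 (frameIn p q v) (frameIn p q w)
  rw [frameIn_apply p q hq, frameIn_apply p q hq]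
  rfl

lemma contMDiff_metricForm (a : ℝ) : ContMDiff model
    (model.prod 𝓘(ℝ, (ℂ × EuclideanSpace ℝ (Fin 1)) →L[ℝ]
      (ℂ × EuclideanSpace ℝ (Fin 1)) →L[ℝ] ℝ)) ∞
    (fun p : EuclideanBTZ a ↦ Bundle.TotalSpace.mk' ((ℂ × EuclideanSpace ℝ (Fin 1)) →L[ℝ]
      (ℂ × EuclideanSpace ℝ (Fin 1)) →L[ℝ] ℝ) (E := fun p : EuclideanBTZ a ↦
        TangentSpace model p →L[ℝ] TangentSpace model p →L[ℝ] ℝ) p (metricForm p)) := by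
  intro p
  refine (Bundle.contMDiffAt_section p).2 ?_
  refine (contMDiffAt_metricIn p).congr_of_eventuallyEq ?_
  have h := (trivializationAt (ℂ × EuclideanSpace ℝ (Fin 1))
    (TangentSpace model : EuclideanBTZ a → Type) p).open_baseSet.mem_nhds
      (FiberBundle.mem_baseSet_trivializationAt' p)
  exact Filter.mem_of_superset h fun q hq ↦ metricIn_eq p q hq

/-- The nonrotating Euclidean BTZ metric, as a smooth Riemannian metric. -/
def metric (a : ℝ) [Fact (0 < a)] :
    Bundle.ContMDiffRiemannianMetric model ∞ (ℂ × EuclideanSpace ℝ (Fin 1))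
      (fun p : EuclideanBTZ a ↦ TangentSpace model p) where
  inner p := metricForm p
  symm p v w := metricForm_symm p v w
  pos p _ hv := metricForm_pos Fact.out p hv
  isVonNBounded p := metricForm_bounded Fact.out p
  contMDiff := contMDiff_metricForm a

/-- The tangent spaces carry the BTZ metric. -/
instance (a : ℝ) [Fact (0 < a)] :
    Bundle.RiemannianBundle (fun p : EuclideanBTZ a ↦ TangentSpace model p) :=
  ⟨(metric a).toRiemannianMetric⟩

open Bundle in
instance (a : ℝ) [Fact (0 < a)] : IsContinuousRiemannianBundle
    (ℂ × EuclideanSpace ℝ (Fin 1)) (fun p : EuclideanBTZ a ↦ TangentSpace model p) :=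
  ⟨⟨(metric a).inner, (metric a).contMDiff.continuous, fun _ _ _ ↦ rfl⟩⟩

open Bundle in
/-- The BTZ space is a metric space for its Riemannian distance: the distance of two points is the
infimum of the lengths of the `C¹` paths between them. -/
instance (a : ℝ) [Fact (0 < a)] : EMetricSpace (EuclideanBTZ a) :=
  .ofRiemannianMetric model (EuclideanBTZ a)

/-- The coordinates `(ρ, τ, φ)` on the BTZ space, for `a ≤ ρ`. -/
def polar (a : ℝ) (x : ℝ × ℝ × ℝ) : EuclideanBTZ a :=
  ((√(x.1 ^ 2 - a ^ 2) / a : ℝ) * (Circle.exp (a * x.2.1) : ℂ), Circle.exp x.2.2)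

lemma hasFDerivAt_coords_polar {a : ℝ} (ha : 0 < a) {x : ℝ × ℝ × ℝ} (hx : a < x.1) :
    ∃ D : ℝ × ℝ × ℝ →L[ℝ] ℂ × ℂ, HasFDerivAt (fun y ↦ coords (polar a y)) D x ∧
      ∀ v, D v = (((x.1 / √(x.1 ^ 2 - a ^ 2) / a * v.1 : ℝ) +
        (√(x.1 ^ 2 - a ^ 2) * v.2.1 : ℝ) * Complex.I) * (Circle.exp (a * x.2.1) : ℂ),
        v.2.2 * Complex.I * (Circle.exp x.2.2 : ℂ)) := by
  have hpos : 0 < x.1 ^ 2 - a ^ 2 := by nlinarith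
  have hne : √(x.1 ^ 2 - a ^ 2) ≠ 0 := (Real.sqrt_pos.2 hpos).ne'
  have hρ : HasFDerivAt (fun y : ℝ × ℝ × ℝ ↦ y.1) (.fst ℝ ℝ (ℝ × ℝ)) x := hasFDerivAt_fst
  have hτ : HasFDerivAt (fun y : ℝ × ℝ × ℝ ↦ y.2.1) (.fst ℝ ℝ ℝ ∘L .snd ℝ ℝ (ℝ × ℝ)) x :=
    hasFDerivAt_fst.comp x hasFDerivAt_snd
  have hφ : HasFDerivAt (fun y : ℝ × ℝ × ℝ ↦ y.2.2) (.snd ℝ ℝ ℝ ∘L .snd ℝ ℝ (ℝ × ℝ)) x :=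
    hasFDerivAt_snd.comp x hasFDerivAt_snd
  have hs := ((hρ.pow 2).sub_const (a ^ 2)).sqrt hpos.ne'
  have hs' := Complex.ofRealCLM.hasFDerivAt.comp x (hs.mul_const a⁻¹)
  have hE (t : ℝ) : HasDerivAt (fun t : ℝ ↦ (Circle.exp t : ℂ)) (Circle.exp t * Complex.I) t := by
    simp only [Circle.coe_exp]
    simpa using ((Complex.ofRealCLM.hasDerivAt (x := t)).mul_const Complex.I).cexp
  have hτ' := (hE (a * x.2.1)).hasFDerivAt.comp (f := fun y : ℝ × ℝ × ℝ ↦ a * y.2.1) x (hτ.const_mul a)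
  have hφ' := (hE x.2.2).hasFDerivAt.comp (f := fun y : ℝ × ℝ × ℝ ↦ y.2.2) x hφ
  refine ⟨_, (hs'.mul hτ').prodMk hφ', fun v ↦ ?_⟩
  have ha' : (a : ℂ) ≠ 0 := mod_cast ha.ne'
  have hne' : ((√(x.1 ^ 2 - a ^ 2) : ℝ) : ℂ) ≠ 0 := mod_cast hne
  refine Prod.ext ?_ ?_
  · simp
    field_simp
    ring
  · simp
    ring

lemma inner_mul_circle (z w : ℂ) (e : Circle) : ⟪z * e, w * e⟫_ℝ = ⟪z, w⟫_ℝ := by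
  have h := Circle.normSq_coe e
  rw [Complex.normSq_apply] at h
  simp only [Complex.inner, Complex.mul_re, Complex.mul_im, map_mul, Complex.conj_re,
    Complex.conj_im]
  linear_combination (z.re * w.re + z.im * w.im) * h

/-- In the coordinates `(ρ, τ, φ)` the metric is
`ds² = (ρ² - a²) dτ² + dρ² / (ρ² - a²) + ρ² dφ²`. -/
theorem metricForm_polar {a : ℝ} (ha : 0 < a) {x : ℝ × ℝ × ℝ} (hx : a < x.1) (v : ℝ × ℝ × ℝ) :
    metricForm (polar a x) (mfderiv 𝓘(ℝ, ℝ × ℝ × ℝ) model (polar a) x v)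
      (mfderiv 𝓘(ℝ, ℝ × ℝ × ℝ) model (polar a) x v) =
    (x.1 ^ 2 - a ^ 2) * v.2.1 ^ 2 + v.1 ^ 2 / (x.1 ^ 2 - a ^ 2) + x.1 ^ 2 * v.2.2 ^ 2 := by
  have hpos : 0 < x.1 ^ 2 - a ^ 2 := by nlinarith
  obtain ⟨D, hD, hDv⟩ := hasFDerivAt_coords_polar ha hx
  have hpol : MDifferentiableAt 𝓘(ℝ, ℝ × ℝ × ℝ) model (polar a) x := by
    have h1 : MDifferentiableAt 𝓘(ℝ, ℝ × ℝ × ℝ) 𝓘(ℝ, ℂ) (fun y ↦ (polar a y).1) x :=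
      hD.differentiableAt.fst.mdifferentiableAt
    have h2 : MDifferentiableAt 𝓘(ℝ, ℝ × ℝ × ℝ) (𝓡 1) (fun y ↦ (polar a y).2) x := by
      have h3 : MDifferentiableAt 𝓘(ℝ, ℝ × ℝ × ℝ) 𝓘(ℝ, ℝ) (fun y : ℝ × ℝ × ℝ ↦ y.2.2) x :=
        (by fun_prop : DifferentiableAt ℝ (fun y : ℝ × ℝ × ℝ ↦ y.2.2) x).mdifferentiableAt
      exact MDifferentiableAt.comp (f := fun y : ℝ × ℝ × ℝ ↦ y.2.2) (g := Circle.exp) x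
        ((contMDiff_circleExp (m := 1) x.2.2).mdifferentiableAt one_ne_zero) h3
    exact h1.prodMk h2
  have hc := (contMDiff_coords a (polar a x)).mdifferentiableAt (by simp)
  have hfr : frame (polar a x) (mfderiv 𝓘(ℝ, ℝ × ℝ × ℝ) model (polar a) x v) = D v :=
    congrArg (fun f ↦ f v) (hasMFDerivAt_unique (hc.hasMFDerivAt.comp x hpol.hasMFDerivAt)
      hD.hasMFDerivAt)
  change ambientForm a (polar a x).1 (frame (polar a x) _) (frame (polar a x) _) = _
  rw [hfr, ambientForm_apply, hDv]
  have hs := Real.sq_sqrt hpos.le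
  have hne : √(x.1 ^ 2 - a ^ 2) ≠ 0 := (Real.sqrt_pos.2 hpos).ne'
  have hZ : (polar a x).1 =
      ((√(x.1 ^ 2 - a ^ 2) / a : ℝ) : ℂ) * (Circle.exp (a * x.2.1) : ℂ) := rfl
  have hz : ‖(polar a x).1‖ ^ 2 = (x.1 ^ 2 - a ^ 2) / a ^ 2 := by
    rw [hZ, norm_mul, Circle.norm_coe, mul_one, Complex.norm_real, Real.norm_eq_abs, sq_abs,
      div_pow, hs]
  rw [hz, hZ, inner_mul_circle, inner_mul_circle, inner_mul_circle]
  simp only [Complex.inner, Complex.mul_re, Complex.mul_im, Complex.add_re, Complex.add_im,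
    Complex.conj_re, Complex.conj_im, Complex.ofReal_re, Complex.ofReal_im, Complex.I_re,
    Complex.I_im]
  field_simp
  rw [hs]
  field_simp
  linear_combination (x.1 ^ 4 * a ^ 2 - x.1 ^ 2 * a ^ 4) * v.2.1 ^ 2 * hs

/-- Every point of the BTZ space has coordinates `(ρ, τ, φ)` with `a ≤ ρ`. -/
theorem exists_polar_eq {a : ℝ} (ha : 0 < a) (p : EuclideanBTZ a) :
    ∃ x : ℝ × ℝ × ℝ, a ≤ x.1 ∧ polar a x = p := by
  have h1 : (1 : ℝ) ≤ √(1 + ‖p.1‖ ^ 2) := by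
    rw [Real.one_le_sqrt]
    nlinarith [sq_nonneg ‖p.1‖]
  refine ⟨(a * √(1 + ‖p.1‖ ^ 2), Complex.arg p.1 / a, Complex.arg p.2), by nlinarith, ?_⟩
  have h2 : (a * √(1 + ‖p.1‖ ^ 2)) ^ 2 - a ^ 2 = (a * ‖p.1‖) ^ 2 := by
    rw [mul_pow, Real.sq_sqrt (by positivity)]
    ring
  refine Prod.ext ?_ (Circle.exp_arg p.2)
  change ((√((a * √(1 + ‖p.1‖ ^ 2)) ^ 2 - a ^ 2) / a : ℝ) : ℂ) *
    (Circle.exp (a * (Complex.arg p.1 / a)) : ℂ) = p.1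
  rw [h2, Real.sqrt_sq (by positivity), mul_div_cancel_left₀ _ ha.ne', mul_div_cancel₀ _ ha.ne',
    Circle.coe_exp, Complex.norm_mul_exp_arg_mul_I]

/-- The identifications of the coordinates: `φ ∼ φ + 2π`, `τ ∼ τ + 2π / a`, and `τ` is
irrelevant at `ρ = a`. -/
theorem polar_eq_polar_iff {a : ℝ} (ha : 0 < a) {x y : ℝ × ℝ × ℝ} (hx : a ≤ x.1)
    (hy : a ≤ y.1) :
    polar a x = polar a y ↔ x.1 = y.1 ∧ (∃ n : ℤ, x.2.2 = y.2.2 + n * (2 * Real.pi)) ∧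
      (x.1 = a ∨ ∃ m : ℤ, x.2.1 = y.2.1 + m * (2 * Real.pi / a)) := by
  have hφ := Circle.exp_eq_exp (x := x.2.2) (y := y.2.2)
  have hτ := Circle.exp_eq_exp (x := a * x.2.1) (y := a * y.2.1)
  have hτ' : (∃ m : ℤ, a * x.2.1 = a * y.2.1 + m * (2 * Real.pi)) ↔
      ∃ m : ℤ, x.2.1 = y.2.1 + m * (2 * Real.pi / a) := by
    refine exists_congr fun m ↦ ?_
    have : a * x.2.1 = a * y.2.1 + m * (2 * Real.pi) ↔
        a * x.2.1 = a * (y.2.1 + m * (2 * Real.pi / a)) := by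
      field_simp
    rw [this, mul_right_inj' ha.ne']
  rw [← hφ, ← hτ', ← hτ]
  constructor
  · intro h
    have h1 : ((√(x.1 ^ 2 - a ^ 2) / a : ℝ) : ℂ) * (Circle.exp (a * x.2.1) : ℂ) =
        ((√(y.1 ^ 2 - a ^ 2) / a : ℝ) : ℂ) * (Circle.exp (a * y.2.1) : ℂ) := congrArg Prod.fst h
    have h2 : Circle.exp x.2.2 = Circle.exp y.2.2 := congrArg Prod.snd h
    have h3 := congrArg (‖·‖) h1
    simp only [norm_mul, Circle.norm_coe, mul_one, Complex.norm_real, Real.norm_eq_abs,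
      abs_of_nonneg (div_nonneg (Real.sqrt_nonneg _) ha.le)] at h3
    have h4 : √(x.1 ^ 2 - a ^ 2) = √(y.1 ^ 2 - a ^ 2) := by
      field_simp at h3
      exact h3
    have h5 : x.1 ^ 2 = y.1 ^ 2 := by
      have := (Real.sqrt_inj (by nlinarith) (by nlinarith)).1 h4
      linarith
    have h6 : x.1 = y.1 := by
      rwa [sq_eq_sq₀ (by linarith) (by linarith)] at h5
    refine ⟨h6, h2, ?_⟩
    by_cases hxa : x.1 = a
    · exact Or.inl hxa
    · right
      have hpos : 0 < x.1 ^ 2 - a ^ 2 := by nlinarith [lt_of_le_of_ne hx (Ne.symm hxa)]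
      rw [← h4] at h1
      have hne : ((√(x.1 ^ 2 - a ^ 2) / a : ℝ) : ℂ) ≠ 0 := by
        exact_mod_cast (div_pos (Real.sqrt_pos.2 hpos) ha).ne'
      exact Circle.ext (mul_left_cancel₀ hne h1)
  · rintro ⟨h1, h2, h3⟩
    refine Prod.ext ?_ h2
    change ((√(x.1 ^ 2 - a ^ 2) / a : ℝ) : ℂ) * (Circle.exp (a * x.2.1) : ℂ) =
        ((√(y.1 ^ 2 - a ^ 2) / a : ℝ) : ℂ) * (Circle.exp (a * y.2.1) : ℂ)
    rcases h3 with h3 | h3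
    · rw [← h1, h3]
      simp
    · rw [h1, h3]

open Bundle in
instance (a : ℝ) [Fact (0 < a)] : IsRiemannianManifold model (EuclideanBTZ a) :=
  ⟨fun _ _ ↦ rfl⟩

end EuclideanBTZ

/-- The solid torus `D₂ × S¹ = {(x, y, φ) | x² + y² < 1, φ ∼ φ + 2π}` (as a set; `Real.Angle` is
`ℝ / 2πℤ`, and `Real.Angle.toReal` is the representative in `(-π, π]`). -/
structure Donut where
  x : ℝ
  y : ℝ
  φ : Real.Angle
  mem_disc : x ^ 2 + y ^ 2 < 1

end

namespace EuclideanBTZ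

attribute [local instance] finrank_real_complex_fact'

open MeasureTheory Bundle

/-! The universal cover `ℂ × ℝ` of the BTZ space, with coordinates `(Z, φ)`, is hyperbolic 3-space.
With `A = √(1 + |Z|²)`, the map `(Z, φ) ↦ (Z, S, T) = (Z, A sinh aφ, A cosh aφ)` identifies it with
the sheet `T > 0` of `T² - S² - |Z|² = 1`, and the BTZ metric with the one induced by `|dZ|² + dS² -
dT²`. The function `coshDist` is minus the Minkowski product of two points of this sheet, hence the
hyperbolic cosine of their distance.

This is proved by hand through two bounds. Along a `C¹` curve, lifted by `exists_lift_circle`, the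
function `h = coshDist` from the starting point satisfies `|h'| ≤ √(h² - 1) · speed`
(`coshDist_deriv_sq_le`), and integration bounds the length below by `arcosh h`
(`exists_arcosh_le_pathELength`). Conversely, the section of the hyperboloid by the plane through
the origin and two points projects to a unit-speed curve of exactly that length (`edist_exp_le`).

Downstairs the distance is the least one over all lifts. As `coshDist` increases with `|θ|`, the
least value occurs at the angle difference of least absolute value, the representative in `(-π, π]`
(`edist_eq`). Finally `(x, y) = Z / √(1 + |Z|²)` is the Klein model, which turns `coshDist` into the
required formula. -/

/-! ### Lengths of curves in the coordinates `(Z, e^{iφ})`. -/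

lemma frame_mfderiv_apply_one {a : ℝ} {γ : ℝ → EuclideanBTZ a} {t : ℝ}
    (hγ : MDifferentiableAt 𝓘(ℝ, ℝ) model γ t) :
    frame (γ t) (mfderiv 𝓘(ℝ, ℝ) model γ t 1) = deriv (fun s ↦ coords (γ s)) t := by
  have hc := (contMDiff_coords a (γ t)).mdifferentiableAt (by simp)
  have h := hc.hasMFDerivAt.comp t hγ.hasMFDerivAt
  have hd : DifferentiableAt ℝ (fun s ↦ coords (γ s)) t :=
    (h.mdifferentiableAt : MDifferentiableAt 𝓘(ℝ, ℝ) 𝓘(ℝ, ℂ × ℂ) _ t).differentiableAt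
  have h' := congrArg (fun f ↦ f (1 : ℝ))
    (hasMFDerivAt_unique h hd.hasDerivAt.hasFDerivAt.hasMFDerivAt)
  exact h'.trans (one_smul ℝ _)

lemma enorm_mfderiv_apply_one {a : ℝ} [Fact (0 < a)] {γ : ℝ → EuclideanBTZ a} {t : ℝ}
    (hγ : MDifferentiableAt 𝓘(ℝ, ℝ) model γ t) :
    ‖mfderiv 𝓘(ℝ, ℝ) model γ t 1‖ₑ = ENNReal.ofReal √(ambientForm a (γ t).1
      (deriv (fun s ↦ coords (γ s)) t) (deriv (fun s ↦ coords (γ s)) t)) := by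
  rw [← ofReal_norm, norm_eq_sqrt_real_inner, ← frame_mfderiv_apply_one hγ]
  rfl

/-- Reduces lengths on the manifold to ordinary calculus in `ℂ × ℂ`: by the chain rule, `frame`
sends the velocity of a curve to the derivative of its coordinates. -/
lemma pathELength_eq {a : ℝ} [Fact (0 < a)] {γ : ℝ → EuclideanBTZ a}
    (hγ : ContMDiff 𝓘(ℝ, ℝ) model 1 γ) (b c : ℝ) :
    Manifold.pathELength model γ b c = ∫⁻ t in Set.Icc b c, ENNReal.ofReal √(ambientForm a (γ t).1
      (deriv (fun s ↦ coords (γ s)) t) (deriv (fun s ↦ coords (γ s)) t)) := by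
  rw [Manifold.pathELength_eq_lintegral_mfderiv_Icc]
  exact lintegral_congr fun t ↦ enorm_mfderiv_apply_one ((hγ t).mdifferentiableAt one_ne_zero)

/-! ### The Minkowski product on the hyperboloid. -/

/-- The hyperbolic cosine of the distance of two points of the universal cover `ℂ × ℝ` of the
BTZ space whose angles differ by `θ / a`. -/
noncomputable def coshDist (z w : ℂ) (θ : ℝ) : ℝ :=
  √(1 + ‖z‖ ^ 2) * √(1 + ‖w‖ ^ 2) * Real.cosh θ - ⟪z, w⟫_ℝ

/-- The difference of the two sides is `|z|² |w|² - ⟪z, w⟫²`, so this is Cauchy–Schwarz. Keeping the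
term `‖z - w‖ ^ 2` is what settles the equality case of `one_le_coshDist`. -/
lemma one_add_inner_le (z w : ℂ) :
    (1 + ⟪z, w⟫_ℝ) ^ 2 + ‖z - w‖ ^ 2 ≤ (√(1 + ‖z‖ ^ 2) * √(1 + ‖w‖ ^ 2)) ^ 2 := by
  rw [mul_pow, Real.sq_sqrt (by positivity), Real.sq_sqrt (by positivity), norm_sub_sq_real]
  nlinarith [real_inner_mul_inner_self_le z w, real_inner_self_eq_norm_sq z,
      real_inner_self_eq_norm_sq w]

lemma one_le_coshDist (z w : ℂ) (θ : ℝ) : 1 ≤ coshDist z w θ := by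
  have h1 : 1 + ⟪z, w⟫_ℝ ≤ √(1 + ‖z‖ ^ 2) * √(1 + ‖w‖ ^ 2) :=
    le_of_sq_le_sq (by nlinarith [one_add_inner_le z w, sq_nonneg ‖z - w‖]) (by positivity)
  have h2 := mul_le_mul_of_nonneg_left (Real.one_le_cosh θ)
    (by positivity : 0 ≤ √(1 + ‖z‖ ^ 2) * √(1 + ‖w‖ ^ 2))
  rw [coshDist]
  linarith

/-- The bound `1 ≤ coshDist z w 0` leaves no room for `cosh θ > 1`; after that, equality in
`one_add_inner_le` forces `‖z - w‖ = 0`. -/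
lemma eq_of_coshDist_eq_one {z w : ℂ} {θ : ℝ} (h : coshDist z w θ = 1) : z = w ∧ θ = 0 := by
  have h0 : 0 < √(1 + ‖z‖ ^ 2) * √(1 + ‖w‖ ^ 2) := by positivity
  have h1 : 1 ≤ coshDist z w 0 := one_le_coshDist z w 0
  rw [coshDist] at h h1
  have h2 : Real.cosh θ = 1 := by
    refine le_antisymm ?_ (Real.one_le_cosh θ)
    refine le_of_mul_le_mul_left ?_ h0
    rw [Real.cosh_zero] at h1
    linarith
  have h3 : θ = 0 := by
    by_contra hθ
    exact (Real.one_lt_cosh.2 hθ).ne' h2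
  refine ⟨?_, h3⟩
  have h4 := one_add_inner_le z w
  rw [show √(1 + ‖z‖ ^ 2) * √(1 + ‖w‖ ^ 2) = 1 + ⟪z, w⟫_ℝ by rw [h2] at h; linarith] at h4
  have h5 : ‖z - w‖ = 0 := by nlinarith [norm_nonneg (z - w)]
  exact sub_eq_zero.1 (norm_eq_zero.1 h5)

/-! ### Lower bound for the length of a curve. -/

/-- A `C¹` curve on the circle lifts to the line. -/
lemma exists_lift_circle {u : ℝ → Circle} (hu : ContDiff ℝ 1 fun t ↦ (u t : ℂ)) (t₀ φ₀ : ℝ)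
    (h₀ : u t₀ = Circle.exp φ₀) :
    ∃ φ : ℝ → ℝ, φ t₀ = φ₀ ∧ (∀ t, u t = Circle.exp (φ t)) ∧ ∀ t, DifferentiableAt ℝ φ t := by
  set v : ℝ → ℂ := fun t ↦ (u t : ℂ)
  have hv (t : ℝ) : HasDerivAt v (deriv v t) t := (hu.differentiable one_ne_zero t).hasDerivAt
  have hn (t : ℝ) : ⟪v t, v t⟫_ℝ = 1 := by
    rw [real_inner_self_eq_norm_sq, Circle.norm_coe, one_pow]
  have hperp (t : ℝ) : ⟪v t, deriv v t⟫_ℝ = 0 := by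
    have h := (hv t).inner ℝ (hv t)
    simp only [hn] at h
    have := h.unique (hasDerivAt_const t (1 : ℝ))
    rw [real_inner_comm (v t)] at this
    linarith
  -- The angular speed: `v` and `iv` form an orthonormal basis and `v'` is orthogonal to `v`, so `v'
  -- = f i v`. The lift is a primitive `φ` of `f`, because `e^{-iφ} v` then has zero derivative.
  set f : ℝ → ℝ := fun t ↦ ⟪v t * Complex.I, deriv v t⟫_ℝ
  have hf : Continuous f := (hu.continuous.mul continuous_const).inner (hu.continuous_deriv le_rfl)
  have hderiv (t : ℝ) : deriv v t = f t * Complex.I * v t := by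
    have h1 := hn t
    have h2 := hperp t
    simp only [f, Complex.inner, Complex.mul_re, Complex.conj_re, Complex.conj_im,
      Complex.mul_im, Complex.I_re, Complex.I_im] at h1 h2 ⊢
    refine Complex.ext ?_ ?_
    · simp
      linear_combination (v t).re * h2 - (deriv v t).re * h1
    · simp
      linear_combination (v t).im * h2 - (deriv v t).im * h1
  have hφ (t : ℝ) : HasDerivAt (fun t ↦ φ₀ + ∫ s in t₀..t, f s) (f t) t :=
    (hf.integral_hasStrictDerivAt t₀ t).hasDerivAt.const_add φ₀
  set φ : ℝ → ℝ := fun t ↦ φ₀ + ∫ s in t₀..t, f s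
  have hφ₀ : φ t₀ = φ₀ := by simp [φ]
  have hconst (t : ℝ) : HasDerivAt (fun t ↦ Complex.exp (-(φ t * Complex.I)) * v t) 0 t := by
    have h := ((((hφ t).ofReal_comp.mul_const Complex.I).neg).cexp).mul (hv t)
    refine h.congr_deriv ?_
    rw [hderiv]
    ring
  refine ⟨φ, hφ₀, fun t ↦ ?_, fun t ↦ (hφ t).differentiableAt⟩
  have h1 := is_const_of_deriv_eq_zero (fun t ↦ (hconst t).differentiableAt)
    (fun t ↦ (hconst t).deriv) t t₀
  have h2 : v t₀ = Complex.exp (φ₀ * Complex.I) := by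
    simp only [v, h₀, Circle.coe_exp]
  simp only [hφ₀, h2, ← Complex.exp_add, neg_add_cancel, Complex.exp_zero] at h1
  refine Circle.ext ?_
  rw [Circle.coe_exp]
  rw [Complex.exp_neg, inv_mul_eq_one₀ (Complex.exp_ne_zero _)] at h1
  exact h1.symm

lemma ambientForm_self_nonneg (a : ℝ) (z : ℂ) (V : ℂ × ℂ) : 0 ≤ ambientForm a z V V :=
  le_trans (by positivity) (ambientForm_ge a z V)

lemma ambientForm_sq_le (a : ℝ) (z : ℂ) (V W : ℂ × ℂ) :
    ambientForm a z V W ^ 2 ≤ ambientForm a z V V * ambientForm a z W W := by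
  refine LinearMap.BilinForm.apply_sq_le_of_symm (ambientForm a z).toBilinForm
    (ambientForm_self_nonneg a z) ⟨fun V W ↦ ?_⟩ V W
  change ambientForm a z V W = ambientForm a z W V
  rw [ambientForm_apply, ambientForm_apply, real_inner_comm V.1 W.1, real_inner_comm V.2 W.2]
  ring

lemma inner_mul_I_circle (r s : ℝ) (u : Circle) :
    ⟪(r : ℂ) * Complex.I * u, (s : ℂ) * Complex.I * u⟫_ℝ = r * s := by
  rw [inner_mul_circle]
  simp [Complex.inner]
  ring

lemma ambientForm_apply_circle {a : ℝ} (z v w : ℂ) (r s : ℝ) (u : Circle) :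
    ambientForm a z (v, r * Complex.I * u) (w, s * Complex.I * u) =
      ⟪v, w⟫_ℝ - ⟪z, v⟫_ℝ * ⟪z, w⟫_ℝ / (1 + ‖z‖ ^ 2) + a ^ 2 * (1 + ‖z‖ ^ 2) * (r * s) := by
  rw [ambientForm_apply, inner_mul_I_circle]

/-- The gradient of `h = cosh d(X₀, ·)` on hyperbolic space has squared norm `h² - 1 = sinh² d`, so
this is Cauchy–Schwarz for the gradient and the velocity. -/
lemma coshDist_deriv_sq_le {a : ℝ} (ha : 0 < a) (z₀ z v : ℂ) (u : Circle) (θ r : ℝ) :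
    (√(1 + ‖z₀‖ ^ 2) * (⟪z, v⟫_ℝ / √(1 + ‖z‖ ^ 2) * Real.cosh θ +
      √(1 + ‖z‖ ^ 2) * (Real.sinh θ * (a * r))) - ⟪z₀, v⟫_ℝ) ^ 2 ≤
    (coshDist z₀ z θ ^ 2 - 1) *
      ambientForm a z (v, r * Complex.I * u) (v, r * Complex.I * u) := by
  set h := coshDist z₀ z θ with hh
  -- This vector is minus the gradient of `h`: the Minkowski-orthogonal projection `X₀ - h X` of
  -- `X₀` to the tangent space at `X`, written in the coordinates `(Z, φ)`. Hence its product with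
  -- the velocity is `-h'` and its square is `h² - 1`.
  have key := ambientForm_sq_le a z (z₀ - h * z,
    (-(√(1 + ‖z₀‖ ^ 2) * Real.sinh θ / (a * √(1 + ‖z‖ ^ 2))) : ℝ) * Complex.I * u)
    (v, r * Complex.I * u)
  have hA₀ : √(1 + ‖z₀‖ ^ 2) ^ 2 = 1 + ‖z₀‖ ^ 2 := Real.sq_sqrt (by positivity)
  have hA : √(1 + ‖z‖ ^ 2) ^ 2 = 1 + ‖z‖ ^ 2 := Real.sq_sqrt (by positivity)
  have hpos : 0 < √(1 + ‖z‖ ^ 2) := by positivity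
  have hc := Real.cosh_sq θ
  rw [coshDist] at hh
  have hsm : (h : ℂ) * z = h • z := by rw [Complex.real_smul]
  have h1 : ambientForm a z (z₀ - h * z,
      (-(√(1 + ‖z₀‖ ^ 2) * Real.sinh θ / (a * √(1 + ‖z‖ ^ 2))) : ℝ) * Complex.I * u)
      (v, r * Complex.I * u) =
      -(√(1 + ‖z₀‖ ^ 2) * (⟪z, v⟫_ℝ / √(1 + ‖z‖ ^ 2) * Real.cosh θ +
      √(1 + ‖z‖ ^ 2) * (Real.sinh θ * (a * r))) - ⟪z₀, v⟫_ℝ) := by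
    rw [ambientForm_apply_circle, hsm, inner_sub_left, inner_sub_right, real_inner_smul_left,
      real_inner_smul_right, real_inner_self_eq_norm_sq, real_inner_comm z₀ z]
    generalize √(1 + ‖z₀‖ ^ 2) = A₀ at *
    generalize √(1 + ‖z‖ ^ 2) = A at *
    have hz : ‖z‖ ^ 2 = A ^ 2 - 1 := by linarith
    rw [← hA, hz]
    have hi : ⟪z₀, z⟫_ℝ = A₀ * A * Real.cosh θ - h := by linarith
    rw [hi]
    field_simp
    ring
  have h2 : ambientForm a z (z₀ - h * z,
      (-(√(1 + ‖z₀‖ ^ 2) * Real.sinh θ / (a * √(1 + ‖z‖ ^ 2))) : ℝ) * Complex.I * u)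
      (z₀ - h * z,
      (-(√(1 + ‖z₀‖ ^ 2) * Real.sinh θ / (a * √(1 + ‖z‖ ^ 2))) : ℝ) * Complex.I * u) =
      h ^ 2 - 1 := by
    rw [ambientForm_apply_circle, hsm]
    simp only [inner_sub_left, inner_sub_right, real_inner_smul_left,
      real_inner_smul_right, real_inner_self_eq_norm_sq, real_inner_comm z₀ z, norm_smul, mul_pow,
      Real.norm_eq_abs, sq_abs]
    generalize √(1 + ‖z₀‖ ^ 2) = A₀ at *
    generalize √(1 + ‖z‖ ^ 2) = A at *
    have hz : ‖z‖ ^ 2 = A ^ 2 - 1 := by linarith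
    have hz₀ : ‖z₀‖ ^ 2 = A₀ ^ 2 - 1 := by linarith
    rw [← hA, hz, hz₀]
    have hi : ⟪z₀, z⟫_ℝ = A₀ * A * Real.cosh θ - h := by linarith
    rw [hi]
    field_simp
    linear_combination (-A ^ 2 * A₀ ^ 2) * hc
  rw [h1, h2, neg_sq] at key
  exact key

lemma hasDerivAt_coshDist {z₀ : ℂ} {Z : ℝ → ℂ} {θ : ℝ → ℝ} {v : ℂ} {r t : ℝ}
    (hZ : HasDerivAt Z v t) (hθ : HasDerivAt θ r t) :
    HasDerivAt (fun t ↦ coshDist z₀ (Z t) (θ t))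
      (√(1 + ‖z₀‖ ^ 2) * (⟪Z t, v⟫_ℝ / √(1 + ‖Z t‖ ^ 2) * Real.cosh (θ t) +
      √(1 + ‖Z t‖ ^ 2) * (Real.sinh (θ t) * r)) - ⟪z₀, v⟫_ℝ) t := by
  have h1 := (hZ.norm_sq.const_add 1).sqrt (by positivity)
  have h2 := ((h1.const_mul √(1 + ‖z₀‖ ^ 2)).mul hθ.cosh).sub
    ((hasDerivAt_const t z₀).inner ℝ hZ)
  refine h2.congr_deriv ?_
  have hpos : 0 < √(1 + ‖Z t‖ ^ 2) := by positivity
  rw [inner_zero_left]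
  field_simp
  ring

/-- If `h` starts at `1` and `|h'| ≤ √(h² - 1) v`, then `arcosh h` grows at speed at most `v`. -/
lemma arcosh_le_integral {h h' v : ℝ → ℝ} (hv : Continuous v) (h0 : h 0 = 1)
    (h1 : ∀ t, 1 ≤ h t) (hd : ∀ t, HasDerivAt h (h' t) t) (hv0 : ∀ t, 0 ≤ v t)
    (hle : ∀ t, h' t ^ 2 ≤ (h t ^ 2 - 1) * v t ^ 2) :
    Real.arcosh (h 1) ≤ ∫ t in (0 : ℝ)..1, v t := by
  -- `arcosh h = log (h + √(h² - 1))` need not be differentiable where `h = 1`, in particular at the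
  -- start. Adding `ε` under the root removes the singularity and keeps the derivative in the form
  -- `h' / √(h² - 1 + ε)`; then `ε → 0`.
  have key (ε : ℝ) (hε : 0 < ε) :
      Real.log (h 1 + √(h 1 ^ 2 - 1 + ε)) ≤ Real.log (1 + √ε) + ∫ t in (0 : ℝ)..1, v t := by
    have hpos (t : ℝ) : 0 < h t ^ 2 - 1 + ε := by nlinarith [h1 t]
    have hg (t : ℝ) : HasDerivAt (fun t ↦ Real.log (h t + √(h t ^ 2 - 1 + ε)))
        (h' t / √(h t ^ 2 - 1 + ε)) t := by
      have hs := Real.sqrt_pos.2 (hpos t)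
      have := (hd t).add (((((hd t).pow 2).sub_const 1).add_const ε).sqrt (hpos t).ne')
      have hne : h t + √(h t ^ 2 - 1 + ε) ≠ 0 := by linarith [h1 t]
      refine (this.log hne).congr_deriv ?_
      simp only [Pi.add_apply, Pi.pow_apply]
      field_simp
      ring
    have hb := intervalIntegral.sub_le_integral_of_hasDeriv_right_of_le (zero_le_one' ℝ)
      (fun t _ ↦ (hg t).continuousAt.continuousWithinAt) (fun t _ ↦ (hg t).hasDerivWithinAt)
      (hv.integrableOn_Icc) (fun t _ ↦ by
        have hs := Real.sqrt_pos.2 (hpos t)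
        rw [div_le_iff₀ hs]
        refine le_of_sq_le_sq ?_ (mul_nonneg (hv0 t) hs.le)
        rw [mul_pow, Real.sq_sqrt (hpos t).le]
        nlinarith [hle t, sq_nonneg (v t)])
    rw [h0] at hb
    have : (1 : ℝ) ^ 2 - 1 + ε = ε := by ring
    rw [this] at hb
    linarith
  have hp : 0 < h 1 + √(h 1 ^ 2 - 1 + 0) := by linarith [h1 1, Real.sqrt_nonneg (h 1 ^ 2 - 1 + 0)]
  have l1 : Filter.Tendsto (fun ε ↦ Real.log (h 1 + √(h 1 ^ 2 - 1 + ε))) (nhdsWithin 0 (Set.Ioi 0))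
      (nhds (Real.log (h 1 + √(h 1 ^ 2 - 1 + 0)))) := by
    have : ContinuousAt (fun ε ↦ Real.log (h 1 + √(h 1 ^ 2 - 1 + ε))) 0 :=
      ContinuousAt.log (by fun_prop) hp.ne'
    exact this.tendsto.mono_left nhdsWithin_le_nhds
  have l2 : Filter.Tendsto (fun ε ↦ Real.log (1 + √ε) + ∫ t in (0 : ℝ)..1, v t)
      (nhdsWithin 0 (Set.Ioi 0)) (nhds (Real.log (1 + √0) + ∫ t in (0 : ℝ)..1, v t)) := by
    have : ContinuousAt (fun ε ↦ Real.log (1 + √ε) + ∫ t in (0 : ℝ)..1, v t) 0 :=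
      (ContinuousAt.log (by fun_prop) (by simp)).add continuousAt_const
    exact this.tendsto.mono_left nhdsWithin_le_nhds
  have l3 := le_of_tendsto_of_tendsto l1 l2
    (Filter.eventually_of_mem self_mem_nhdsWithin fun ε hε ↦ key ε hε)
  simpa [Real.arcosh] using l3

/-- The length of a `C¹` curve is at least the hyperbolic distance of the endpoints of a lift. -/
lemma exists_arcosh_le_pathELength {a : ℝ} [Fact (0 < a)] {γ : ℝ → EuclideanBTZ a}
    (hγ : ContMDiff 𝓘(ℝ, ℝ) model 1 γ) {φ₀ : ℝ} (h₀ : (γ 0).2 = Circle.exp φ₀) :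
    ∃ φ₁ : ℝ, (γ 1).2 = Circle.exp φ₁ ∧
      ENNReal.ofReal (Real.arcosh (coshDist (γ 0).1 (γ 1).1 (a * (φ₁ - φ₀)))) ≤
        Manifold.pathELength model γ 0 1 := by
  have ha : 0 < a := Fact.out
  have hc : ContDiff ℝ 1 fun t ↦ coords (γ t) :=
    contMDiff_iff_contDiff.1 (((contMDiff_coords a).of_le (by simp)).comp hγ)
  obtain ⟨φ, hφ₀, hφ, hφd⟩ := exists_lift_circle (u := fun t ↦ (γ t).2) hc.snd 0 φ₀ h₀
  have hZ (t : ℝ) : HasDerivAt (fun t ↦ (γ t).1) (deriv (fun t ↦ (γ t).1) t) t :=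
    (hc.fst.differentiable one_ne_zero t).hasDerivAt
  have hu (t : ℝ) : HasDerivAt (fun t ↦ ((γ t).2 : ℂ))
      ((deriv φ t : ℝ) * Complex.I * ((γ t).2 : ℂ)) t := by
    simp only [hφ, Circle.coe_exp]
    refine ((hφd t).hasDerivAt.ofReal_comp.mul_const Complex.I).cexp.congr_deriv ?_
    ring
  have hcd (t : ℝ) : deriv (fun t ↦ coords (γ t)) t =
      (deriv (fun t ↦ (γ t).1) t, (deriv φ t : ℝ) * Complex.I * ((γ t).2 : ℂ)) :=
    ((hZ t).prodMk (hu t)).deriv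
  set v : ℝ → ℝ := fun t ↦ √(ambientForm a (γ t).1
      (deriv (fun s ↦ coords (γ s)) t) (deriv (fun s ↦ coords (γ s)) t)) with hvdef
  have hv : Continuous v := by
    have hd := hc.continuous_deriv le_rfl
    exact ((((contDiff_ambientForm a).continuous.comp hc.fst.continuous).clm_apply
      hd).clm_apply hd).sqrt
  refine ⟨φ 1, hφ 1, ?_⟩
  rw [pathELength_eq hγ, ← ofReal_integral_eq_lintegral_ofReal hv.integrableOn_Icc
    (Filter.Eventually.of_forall fun t ↦ Real.sqrt_nonneg _),
    integral_Icc_eq_integral_Ioc, ← intervalIntegral.integral_of_le zero_le_one]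
  refine ENNReal.ofReal_le_ofReal (arcosh_le_integral
    (h := fun t ↦ coshDist (γ 0).1 (γ t).1 (a * (φ t - φ₀))) hv ?_
    (fun t ↦ one_le_coshDist _ _ _) (fun t ↦ hasDerivAt_coshDist (hZ t)
      (((hφd t).hasDerivAt.sub_const φ₀).const_mul a)) (fun t ↦ Real.sqrt_nonneg _) fun t ↦ ?_)
  · rw [hφ₀, sub_self, mul_zero, coshDist, Real.cosh_zero, mul_one,
      Real.mul_self_sqrt (by positivity), real_inner_self_eq_norm_sq]
    ring
  · rw [Real.sq_sqrt (ambientForm_self_nonneg _ _ _), hcd]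
    exact coshDist_deriv_sq_le ha _ _ _ _ _ _

/-! ### Geodesics of the hyperboloid and the upper bound. -/

/-- The speed of the curve `(Z, S, T)` on the hyperboloid `T² - S² - |Z|² = 1`, read in the BTZ
metric, is `1` if it is `1` in Minkowski space. -/
lemma ambientForm_hyperboloid {a : ℝ} (ha : 0 < a) {z z' : ℂ} {T S T' S' : ℝ} (u : Circle)
    (h : T ^ 2 - S ^ 2 = 1 + ‖z‖ ^ 2) (h₁ : T * T' - S * S' = ⟪z, z'⟫_ℝ)
    (h₂ : T' ^ 2 - S' ^ 2 = ‖z'‖ ^ 2 - 1) :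
    ambientForm a z
      (z', ((S' * T - S * T') / (a * (1 + ‖z‖ ^ 2)) : ℝ) * Complex.I * u)
      (z', ((S' * T - S * T') / (a * (1 + ‖z‖ ^ 2)) : ℝ) * Complex.I * u) = 1 := by
  have hpos : 0 < 1 + ‖z‖ ^ 2 := by positivity
  rw [ambientForm_apply_circle, real_inner_self_eq_norm_sq, ← h₁,
    show ‖z'‖ ^ 2 = T' ^ 2 - S' ^ 2 + 1 by linarith]
  rw [← h] at hpos ⊢
  field_simp
  ring

/-- The universal cover of the BTZ space is geodesic, with the distance of hyperbolic space. -/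
lemma edist_exp_le {a : ℝ} [Fact (0 < a)] {x y : EuclideanBTZ a} {φ₀ φ₁ : ℝ}
    (hx : x.2 = Circle.exp φ₀) (hy : y.2 = Circle.exp φ₁) :
    edist x y ≤ ENNReal.ofReal (Real.arcosh (coshDist x.1 y.1 (a * (φ₁ - φ₀)))) := by
  obtain ⟨z₀, u₀⟩ := x
  obtain ⟨z₁, u₁⟩ := y
  obtain rfl : u₀ = _ := hx
  obtain rfl : u₁ = _ := hy
  dsimp only
  have ha : 0 < a := Fact.out
  set θ := a * (φ₁ - φ₀) with hθ
  have h1 := one_le_coshDist z₀ z₁ θ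
  -- Coinciding lifts are set apart, since the geodesic below divides by `sinh D`.
  rcases h1.eq_or_lt with h1 | h1
  · obtain ⟨hz, h0⟩ := eq_of_coshDist_eq_one h1.symm
    have hφ : φ₁ = φ₀ := by
      have := (mul_eq_zero.1 (hθ.symm.trans h0)).resolve_left ha.ne'
      linarith
    rw [hz, hφ]
    exact (edist_self _).trans_le zero_le
  set D := Real.arcosh (coshDist z₀ z₁ θ) with hD
  have hD0 : 0 < D := Real.arcosh_pos h1
  have hC : Real.cosh D = coshDist z₀ z₁ θ := Real.cosh_arcosh h1.le
  have hs : 0 < Real.sinh D := Real.sinh_pos_iff.2 hD0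
  have hDs := Real.cosh_sq D
  rw [coshDist] at hC
  have hA₀ : √(1 + ‖z₀‖ ^ 2) ^ 2 = 1 + ‖z₀‖ ^ 2 := Real.sq_sqrt (by positivity)
  have hA₁ : √(1 + ‖z₁‖ ^ 2) ^ 2 = 1 + ‖z₁‖ ^ 2 := Real.sq_sqrt (by positivity)
  have hA₀p : 0 < √(1 + ‖z₀‖ ^ 2) := by positivity
  have hA₁p : 0 < √(1 + ‖z₁‖ ^ 2) := by positivity
  have hθs := Real.cosh_sq θ
  set A₀ := √(1 + ‖z₀‖ ^ 2)
  set A₁ := √(1 + ‖z₁‖ ^ 2)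
  -- The geodesic is `p X₀ + q X₁`, with angles measured from the first point: `X₀ = (z₀, 0, A₀)`
  -- and `X₁ = (z₁, A₁ sinh θ, A₁ cosh θ)`.
  set p : ℝ → ℝ := fun t ↦ Real.sinh (D - t) / Real.sinh D with hp
  set q : ℝ → ℝ := fun t ↦ Real.sinh t / Real.sinh D with hq
  set p' : ℝ → ℝ := fun t ↦ -Real.cosh (D - t) / Real.sinh D with hp'
  set q' : ℝ → ℝ := fun t ↦ Real.cosh t / Real.sinh D with hq'
  have dp (t : ℝ) : HasDerivAt p (p' t) t := by
    refine (((hasDerivAt_id t).const_sub D).sinh.div_const _).congr_deriv ?_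
    simp [hp']
  have dq (t : ℝ) : HasDerivAt q (q' t) t := (Real.hasDerivAt_sinh t).div_const _
  -- Since the Minkowski product of `X₀` and `X₁` is `-cosh D`, the identities `e1`, `e2`, `e3` say
  -- that the curve stays on the hyperboloid, has unit speed, and has velocity orthogonal to
  -- position.
  have e1 (t : ℝ) : p t ^ 2 + q t ^ 2 + 2 * p t * q t * Real.cosh D = 1 := by
    simp only [hp, hq, Real.sinh_sub]
    field_simp
    linear_combination (-Real.sinh t ^ 2) * hDs + Real.sinh D ^ 2 * Real.cosh_sq t
  have e2 (t : ℝ) : p' t ^ 2 + q' t ^ 2 + 2 * p' t * q' t * Real.cosh D = -1 := by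
    simp only [hp', hq', Real.cosh_sub]
    field_simp
    linear_combination (-Real.cosh t ^ 2) * hDs - Real.sinh D ^ 2 * Real.cosh_sq t
  have e3 (t : ℝ) : p t * p' t + q t * q' t + (p t * q' t + p' t * q t) * Real.cosh D = 0 := by
    simp only [hp', hq', hp, hq, Real.cosh_sub, Real.sinh_sub]
    field_simp
    linear_combination (-Real.sinh t * Real.cosh t) * hDs
  have cp : ContDiff ℝ 1 p := (Real.contDiff_sinh.comp (contDiff_const.sub contDiff_id)).div_const _
  have cq : ContDiff ℝ 1 q := Real.contDiff_sinh.div_const _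
  set T : ℝ → ℝ := fun t ↦ p t * A₀ + q t * (A₁ * Real.cosh θ) with hT
  set S : ℝ → ℝ := fun t ↦ q t * (A₁ * Real.sinh θ) with hS
  set Z : ℝ → ℂ := fun t ↦ p t • z₀ + q t • z₁ with hZ
  have hn (x y : ℝ) : ‖x • z₀ + y • z₁‖ ^ 2 =
      x ^ 2 * (A₀ ^ 2 - 1) + y ^ 2 * (A₁ ^ 2 - 1) + 2 * x * y * ⟪z₀, z₁⟫_ℝ := by
    rw [norm_add_sq_real, norm_smul, norm_smul, real_inner_smul_left, real_inner_smul_right,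
      mul_pow, mul_pow, Real.norm_eq_abs, Real.norm_eq_abs, sq_abs, sq_abs, hA₀, hA₁]
    ring
  have hTS (t : ℝ) : T t ^ 2 - S t ^ 2 = 1 + ‖Z t‖ ^ 2 := by
    simp only [hZ, hn, hT, hS]
    linear_combination q t ^ 2 * A₁ ^ 2 * hθs + e1 t - 2 * p t * q t * hC
  have hTS0 (t : ℝ) : (T t + S t) * (T t - S t) ≠ 0 := by
    have : 0 < 1 + ‖Z t‖ ^ 2 := by positivity
    rw [← hTS] at this
    nlinarith
  have hp0 (t : ℝ) : T t + S t ≠ 0 := left_ne_zero_of_mul (hTS0 t)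
  have hm0 (t : ℝ) : T t - S t ≠ 0 := right_ne_zero_of_mul (hTS0 t)
  have dT (t : ℝ) : HasDerivAt T (p' t * A₀ + q' t * (A₁ * Real.cosh θ)) t :=
    ((dp t).mul_const _).add ((dq t).mul_const _)
  have dS (t : ℝ) : HasDerivAt S (q' t * (A₁ * Real.sinh θ)) t := (dq t).mul_const _
  have dZ (t : ℝ) : HasDerivAt Z (p' t • z₀ + q' t • z₁) t :=
    ((dp t).smul_const _).add ((dq t).smul_const _)
  have cT : ContDiff ℝ 1 T := (cp.mul contDiff_const).add (cq.mul contDiff_const)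
  have cS : ContDiff ℝ 1 S := cq.mul contDiff_const
  have cZ : ContDiff ℝ 1 Z := (cp.smul contDiff_const).add (cq.smul contDiff_const)
  -- This is `φ₀ + artanh (S / T) / a`. Smoothness only needs `T ± S ≠ 0`, so the signs of these
  -- factors are never determined.
  set φ : ℝ → ℝ := fun t ↦ φ₀ + (Real.log (T t + S t) - Real.log (T t - S t)) / (2 * a) with hφ
  have cφ : ContDiff ℝ 1 φ :=
    contDiff_const.add ((((cT.add cS).log hp0).sub ((cT.sub cS).log hm0)).div_const _)
  set T' : ℝ → ℝ := fun t ↦ p' t * A₀ + q' t * (A₁ * Real.cosh θ) with hT'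
  set S' : ℝ → ℝ := fun t ↦ q' t * (A₁ * Real.sinh θ) with hS'
  have dφ (t : ℝ) : HasDerivAt φ ((S' t * T t - S t * T' t) / (a * (1 + ‖Z t‖ ^ 2))) t := by
    refine ((((((dT t).add (dS t)).log (hp0 t)).sub (((dT t).sub (dS t)).log (hm0 t))).div_const
      (2 * a)).const_add φ₀).congr_deriv ?_
    have h3 := hp0 t
    have h4 := hm0 t
    rw [← hTS, sq_sub_sq]
    simp only [Pi.add_apply, Pi.sub_apply]
    field_simp
    ring
  set γ : ℝ → EuclideanBTZ a := fun t ↦ (Z t, Circle.exp (φ t))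
  have hγ : ContMDiff 𝓘(ℝ, ℝ) model 1 γ :=
    ContMDiff.prodMk (I' := 𝓘(ℝ, ℂ)) (J' := 𝓡 1) cZ.contMDiff
      (contMDiff_circleExp.comp cφ.contMDiff)
  have hγ0 : γ 0 = (z₀, Circle.exp φ₀) := by
    have h3 : p 0 = 1 := by simp [hp, hs.ne']
    have h4 : q 0 = 0 := by simp [hq]
    refine Prod.ext ?_ ?_ <;> simp [γ, hφ, hZ, hT, hS, h3, h4]
  have hγ1 : γ D = (z₁, Circle.exp φ₁) := by
    have h3 : p D = 0 := by simp [hp]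
    have h4 : q D = 1 := by simp [hq, hs.ne']
    have h5 : φ D = φ₁ := by
      simp only [hφ, hT, hS, h3, h4, zero_mul, zero_add, one_mul, ← mul_add, ← mul_sub,
        Real.cosh_add_sinh, Real.cosh_sub_sinh]
      rw [Real.log_mul hA₁p.ne' (Real.exp_ne_zero _), Real.log_mul hA₁p.ne' (Real.exp_ne_zero _),
        Real.log_exp, Real.log_exp, hθ]
      field_simp
      ring
    refine Prod.ext ?_ ?_ <;> simp [γ, h5, hZ, h3, h4]
  have hcd (t : ℝ) : deriv (fun t ↦ coords (γ t)) t = (p' t • z₀ + q' t • z₁,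
      ((S' t * T t - S t * T' t) / (a * (1 + ‖Z t‖ ^ 2)) : ℝ) * Complex.I * Circle.exp (φ t)) := by
    refine ((dZ t).prodMk ?_).deriv
    simp only [γ, Circle.coe_exp]
    refine ((dφ t).ofReal_comp.mul_const Complex.I).cexp.congr_deriv ?_
    ring
  have hspeed (t : ℝ) : ambientForm a (γ t).1 (deriv (fun s ↦ coords (γ s)) t)
      (deriv (fun s ↦ coords (γ s)) t) = 1 := by
    rw [hcd]
    refine ambientForm_hyperboloid ha (Circle.exp (φ t)) (hTS t) ?_ ?_
    · simp only [γ, hZ, hT, hS, hT', hS', inner_add_left, inner_add_right, real_inner_smul_left,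
        real_inner_smul_right, real_inner_self_eq_norm_sq, real_inner_comm z₀ z₁]
      linear_combination q t * q' t * A₁ ^ 2 * hθs + e3 t - (p t * q' t + p' t * q t) * hC +
        p t * p' t * hA₀ + q t * q' t * hA₁
    · simp only [hn, hT', hS']
      linear_combination q' t ^ 2 * A₁ ^ 2 * hθs + e2 t - 2 * p' t * q' t * hC
  refine (IsRiemannianManifold.out (I := model) (M := EuclideanBTZ a) _ _).trans_le ?_
  refine (Manifold.riemannianEDist_le_pathELength hγ.contMDiffOn hγ0 hγ1 hD0.le).trans_eq ?_
  rw [pathELength_eq hγ]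
  simp [hspeed]

/-! ### Minimising over the lifts. -/

lemma abs_toReal_le_abs {x : ℝ} {θ : Real.Angle} (h : (x : Real.Angle) = θ) : |θ.toReal| ≤ |x| := by
  subst h
  by_cases hx : |x| ≤ Real.pi
  -- At `x = -π` the representative is `π`, with the same absolute value.
  · rcases (abs_le.1 hx).1.eq_or_lt with h | h
    · rw [← h]
      simp [abs_of_pos Real.pi_pos]
    · rw [Real.Angle.toReal_coe_eq_self_iff.2 ⟨h, (abs_le.1 hx).2⟩]
  · exact (Real.Angle.abs_toReal_le_pi _).trans (not_le.1 hx).le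

/-- The Riemannian distance of the BTZ space. -/
theorem edist_eq {a : ℝ} [Fact (0 < a)] {p q : EuclideanBTZ a} {φ₀ φ₁ : Real.Angle}
    (hp : p.2 = φ₀.toCircle) (hq : q.2 = φ₁.toCircle) :
    edist p q = ENNReal.ofReal (Real.arcosh (coshDist p.1 q.1 (a * (φ₀ - φ₁).toReal))) := by
  have ha : 0 < a := Fact.out
  obtain ⟨x, rfl⟩ : ∃ x : ℝ, (x : Real.Angle) = φ₁ := ⟨_, φ₁.coe_toReal⟩
  obtain ⟨y, hy⟩ : ∃ y, y = (φ₀ - x).toReal := ⟨_, rfl⟩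
  obtain rfl : φ₀ = ((x + y : ℝ) : Real.Angle) := by
    rw [Real.Angle.coe_add, hy, Real.Angle.coe_toReal, add_sub_cancel]
  refine le_antisymm ?_ ?_
  · have h := edist_exp_le hq hp
    rw [edist_comm] at h
    refine h.trans_eq ?_
    rw [← hy, add_sub_cancel_left, coshDist, coshDist, real_inner_comm, mul_comm √(1 + ‖q.1‖ ^ 2)]
  · rw [IsRiemannianManifold.out (I := model)]
    refine le_of_forall_gt fun r hr ↦ ?_
    -- An almost minimising curve that is `C¹` on all of `ℝ`, as the lifting lemma requires.
    obtain ⟨γ, h0, h1, hγ, hlen, -⟩ :=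
      Manifold.exists_lt_locally_constant_of_riemannianEDist_lt hr zero_lt_one
    obtain ⟨φ₁, hφ₁, hle⟩ := exists_arcosh_le_pathELength hγ (φ₀ := x + y) (by rw [h0, hp]; rfl)
    refine lt_of_le_of_lt (le_trans (ENNReal.ofReal_le_ofReal ?_) hle) hlen
    rw [Real.arcosh_le_arcosh (zero_lt_one.trans_le (one_le_coshDist _ _ _))
      (zero_lt_one.trans_le (one_le_coshDist _ _ _)), h0, h1, coshDist, coshDist]
    gcongr
    -- The lift may end at any representative of the angle of `q`; `y` has the least absolute value
    -- among the resulting differences, up to sign.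
    rw [Real.cosh_le_cosh, abs_mul, abs_mul, abs_sub_comm φ₁]
    refine mul_le_mul_of_nonneg_left ?_ (abs_nonneg a)
    refine abs_toReal_le_abs ?_
    rw [h1] at hφ₁
    rw [Real.Angle.coe_sub]
    congr 1
    exact Real.Angle.angle_eq_iff_two_pi_dvd_sub.2 (by
      obtain ⟨m, hm⟩ := Circle.exp_eq_exp.1 (show Circle.exp x = Circle.exp φ₁ from hq.symm.trans hφ₁)
      exact ⟨-m, by push_cast; linarith⟩)

end EuclideanBTZ

/-! ### The Klein model on the solid torus. -/

/-- The point of the BTZ space with the coordinates of a point of the solid torus. -/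
noncomputable def Donut.toBTZ (a : ℝ) (p : Donut) : EuclideanBTZ a :=
  ((√(1 - p.x ^ 2 - p.y ^ 2))⁻¹ • (⟨p.x, p.y⟩ : ℂ), p.φ.toCircle)

namespace Donut

lemma one_sub_pos (p : Donut) : 0 < 1 - p.x ^ 2 - p.y ^ 2 := by linarith [p.mem_disc]

/-- The factor `1 / √(1 - x² - y²)` of the Klein model is thus `√(1 + |Z|²)`; this makes the map
injective and supplies the denominators of the distance formula. -/
lemma one_add_norm_sq_toBTZ (a : ℝ) (p : Donut) :
    1 + ‖(p.toBTZ a).1‖ ^ 2 = (1 - p.x ^ 2 - p.y ^ 2)⁻¹ := by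
  have h := p.one_sub_pos
  simp only [toBTZ]
  rw [norm_smul, mul_pow, Complex.sq_norm, Complex.normSq_mk, norm_inv, Real.norm_eq_abs, inv_pow,
    sq_abs, Real.sq_sqrt h.le]
  field_simp
  ring

lemma coshDist_toBTZ (a : ℝ) (p q : Donut) (θ : ℝ) :
    EuclideanBTZ.coshDist (p.toBTZ a).1 (q.toBTZ a).1 θ =
      (Real.cosh θ - p.x * q.x - p.y * q.y) /
          (√(1 - p.x ^ 2 - p.y ^ 2) * √(1 - q.x ^ 2 - q.y ^ 2)) := by
  have hp := Real.sqrt_pos.2 p.one_sub_pos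
  have hq := Real.sqrt_pos.2 q.one_sub_pos
  rw [EuclideanBTZ.coshDist, one_add_norm_sq_toBTZ, one_add_norm_sq_toBTZ, Real.sqrt_inv,
    Real.sqrt_inv]
  simp only [toBTZ, real_inner_smul_left, real_inner_smul_right]
  simp only [Complex.inner, Complex.mul_re, Complex.conj_re, Complex.conj_im]
  field_simp
  ring

lemma bijective_toBTZ (a : ℝ) : Function.Bijective (toBTZ a) := by
  constructor
  · intro p q h
    have h1 : 1 - p.x ^ 2 - p.y ^ 2 = 1 - q.x ^ 2 - q.y ^ 2 := by
      rw [← inv_inj, ← one_add_norm_sq_toBTZ a, h, one_add_norm_sq_toBTZ]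
    have h2 := congrArg Prod.fst h
    have h3 := congrArg Prod.snd h
    simp only [toBTZ] at h2 h3
    rw [h1] at h2
    have h4 := smul_right_injective ℂ (inv_pos.2 (Real.sqrt_pos.2 q.one_sub_pos)).ne' h2
    have h5 : p.φ = q.φ := by
      rw [← Real.Angle.arg_toCircle p.φ, h3, Real.Angle.arg_toCircle]
    cases p
    cases q
    simp only [Complex.mk.injEq] at h4
    simp_all
  · intro b
    have hpos : 0 < 1 + ‖b.1‖ ^ 2 := by positivity
    have hn : ‖b.1‖ ^ 2 = b.1.re ^ 2 + b.1.im ^ 2 := by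
      rw [Complex.sq_norm, Complex.normSq_apply]
      ring
    have hs := Real.sq_sqrt hpos.le
    have hs0 := Real.sqrt_pos.2 hpos
    have h1 : (b.1.re / √(1 + ‖b.1‖ ^ 2)) ^ 2 + (b.1.im / √(1 + ‖b.1‖ ^ 2)) ^ 2 =
        1 - (1 + ‖b.1‖ ^ 2)⁻¹ := by
      rw [div_pow, div_pow, hs, ← add_div, ← hn]
      field_simp
      ring
    refine ⟨⟨b.1.re / √(1 + ‖b.1‖ ^ 2), b.1.im / √(1 + ‖b.1‖ ^ 2), Complex.arg b.2, ?_⟩, ?_⟩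
    · rw [h1]
      linarith [inv_pos.2 hpos]
    · refine Prod.ext ?_ ?_
      · simp only [toBTZ]
        rw [sub_sub, h1, sub_sub_cancel, Real.sqrt_inv, inv_inv]
        refine Complex.ext ?_ ?_
        · simp
          field_simp
        · simp
          field_simp
      · exact Circle.exp_arg b.2

end Donut

theorem mainTheorem5 (a : ℝ) [Fact (0 < a)] :
    ∃ _ : MetricSpace Donut,
      (∀ p q : Donut, Real.cosh (dist p q) =
        (Real.cosh (a * (p.φ - q.φ).toReal) - p.x * q.x - p.y * q.y) /
          (√(1 - p.x ^ 2 - p.y ^ 2) * √(1 - q.x ^ 2 - q.y ^ 2))) ∧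
      Nonempty (Donut ≃ᵢ EuclideanBTZ a) := by
  have hbij := Donut.bijective_toBTZ a
  -- The distance is pulled back along the bijection, which is therefore an isometry by definition;
  -- `edist_eq` gives both its finiteness and its formula.
  let e : EMetricSpace Donut := EMetricSpace.induced (Donut.toBTZ a) hbij.1 inferInstance
  have he (p q : Donut) : edist p q = ENNReal.ofReal (Real.arcosh
      (EuclideanBTZ.coshDist (p.toBTZ a).1 (q.toBTZ a).1 (a * (p.φ - q.φ).toReal))) :=
    EuclideanBTZ.edist_eq rfl rfl
  let m : MetricSpace Donut := EMetricSpace.toMetricSpace fun p q ↦ by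
    rw [he]
    exact ENNReal.ofReal_ne_top
  refine ⟨m, fun p q ↦ ?_, ⟨⟨Equiv.ofBijective _ hbij, fun p q ↦ rfl⟩⟩⟩
  have h1 := EuclideanBTZ.one_le_coshDist (p.toBTZ a).1 (q.toBTZ a).1 (a * (p.φ - q.φ).toReal)
  rw [← Donut.coshDist_toBTZ a, dist_edist, he, ENNReal.toReal_ofReal (Real.arcosh_nonneg h1),
    Real.cosh_arcosh h1]
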